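/- Let $(\Omega,\mathcal A,\mathbf P)$ be a probability space with a filtration $(\mathcal F_i)_{i\in\mathbf Z}$ (an increasing family of sub-$\sigma$-algebras of $\mathcal A$), and put $\mathcal F_{-\infty}=\bigcap_{n\ge0}\mathcal F_{-n}$, $\mathcal F_\infty=\bigvee_{k\in\mathbf Z}\mathcal F_k$ and $P_j(Y)=\mathbf E(Y|\mathcal F_j)-\mathbf E(Y|\mathcal F_{j-1})$ for integrable $Y$. For $\alpha>0$ let $\mathcal A_\alpha$ be the class of nondecreasing continuous functions $\Phi:[0,\infty)\to[0,\infty)$ with $\Phi(0)=0$ and $\Phi(cx)\le c^\alpha\Phi(x)$ for all $c\ge2$, $x\ge0$. For a convex $\Psi\in\mathcal A_\alpha$, not identically zero, let $\|X\|_\Psi=\inf\{c>0:\mathbf E\Psi(|X|/c)\le1\}\in[0,\infty]$ (with $\inf\emptyset=\infty$). For every $\alpha>0$ there is a positive constant $C_\alpha$, depending only on $\alpha$, such that the following holds for every such probability space and filtration. Let $\Psi\in\mathcal A_\alpha$ be convex, not identically zero, and such that $x\mapsto\Psi(\sqrt x)$ is convex on $[0,\infty)$. Let $(Y_k)_{k\in\mathbf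 Z}$ be integrable random variables that are regular, that is, $\mathbf E(Y_k|\mathcal F_{-\infty})=0$ almost surely and $Y_k$ is $\mathcal F_\infty$-measurable for every $k$. Let $(p_j)_{j\in\mathbf Z}$ be nonnegative reals with $\|P_{k-j}(Y_k)\|_\Psi\le p_j$ for all $k,j\in\mathbf Z$ and $D_\Psi:=\sum_{j\in\mathbf Z}p_j<\infty$. Then for every real sequence $(c_j)_{j\in\mathbf Z}$ with $\sum_{j}c_j^2<\infty$ the series $S=\sum_{j\in\mathbf Z}c_jY_j$ converges unconditionally in $\mathbf L^2$, and $$\|S\|_\Psi\le C_\alpha\,D_\Psi\Big(\sum_{j\in\mathbf Z}c_j^2\Big)^{1/2}.$$ -/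

import Mathlib

open MeasureTheory Filter
open scoped ENNReal NNReal Topology

namespace OrliczMoment

/-- The class `𝒜_α`: functions `Φ : ℝ₊ → ℝ₊` with `Φ 0 = 0`, nondecreasing, continuous, and
`Φ (c x) ≤ c ^ α Φ x` for all `c ≥ 2`, `x ≥ 0`. A function on `ℝ₊ = [0, ∞)` is represented by a
function on `ℝ`, of which only the values on `[0, ∞)` are ever used. -/
structure ClassA (α : ℝ) (Φ : ℝ → ℝ) : Prop where
  nonneg : ∀ x : ℝ, 0 ≤ x → 0 ≤ Φ x
  map_zero : Φ 0 = 0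
  monotoneOn : MonotoneOn Φ (Set.Ici 0)
  continuousOn : ContinuousOn Φ (Set.Ici 0)
  growth : ∀ c x : ℝ, 2 ≤ c → 0 ≤ x → Φ (c * x) ≤ c ^ α * Φ x

variable {Ω : Type*} {mΩ : MeasurableSpace Ω}

/-- The Orlicz (Luxemburg) norm `‖X‖_Ψ = inf {c > 0 : E Ψ(|X| / c) ≤ 1}`, with values in
`[0, ∞]`; it is `∞` when there is no such `c`. -/
noncomputable def orliczNorm (Ψ : ℝ → ℝ) (X : Ω → ℝ) (μ : Measure Ω) : ℝ≥0∞ :=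
  ⨅ (c : ℝ) (_ : 0 < c ∧ ∫⁻ ω, ENNReal.ofReal (Ψ (|X ω| / c)) ∂μ ≤ 1), ENNReal.ofReal c

/-- `P_j(Y) = E(Y | ℱ_j) - E(Y | ℱ_{j-1})`. -/
noncomputable def proj (ℱ : Filtration ℤ mΩ) (μ : Measure Ω) (j : ℤ) (Y : Ω → ℝ) : Ω → ℝ :=
  μ[Y | ℱ j] - μ[Y | ℱ (j - 1)]

/-- An integrable random variable `Y` is regular if `E(Y | ℱ_{-∞}) = 0` almost surely and `Y` is
`ℱ_∞`-measurable, where `ℱ_{-∞} = ⋂_{n ≥ 0} ℱ_{-n}` and `ℱ_∞ = ⋁_k ℱ_k`. -/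
structure IsRegular (ℱ : Filtration ℤ mΩ) (μ : Measure Ω) (Y : Ω → ℝ) : Prop where
  integrable : Integrable Y μ
  condExp_bot : μ[Y | ⨅ n : ℕ, ℱ (-(n : ℤ))] =ᵐ[μ] 0
  measurable : Measurable[⨆ k : ℤ, ℱ k] Y

/-- `S = ∑_{j ∈ ℤ} Z_j` in `L²`, i.e. `S ∈ L²` and the finite partial sums converge to `S` in `L²`
along the directed set of all finite subsets of `ℤ` (unconditional convergence). -/
def HasL2Sum (μ : Measure Ω) (Z : ℤ → Ω → ℝ) (S : Ω → ℝ) : Prop :=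
  MemLp S 2 μ ∧
    Tendsto (fun F : Finset ℤ => eLpNorm (fun ω => (∑ j ∈ F, Z j ω) - S ω) 2 μ) atTop (𝓝 0)

end OrliczMoment

/-!
The function `Ψ` behaves like a power of exponent at least `2`: convexity of `x ↦ Ψ (√x)` makes
`Ψ x / x ^ 2` nondecreasing, and the growth condition is a doubling condition with constant `2 ^ α`.
This gives the Orlicz space of `Ψ` martingale type `2`, without Burkholder's inequality. Since `Ψ`
may have kinks, it is replaced by the primitive `F` of the odd function `Ψ |x| / x`, which
satisfies `F x ≤ Ψ |x| ≤ 2 ^ α F x` and, for `|a| ≤ 1`, the Taylor inequality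
`F (x + a z) ≤ F x + a (Ψ |x| / x) z + 4 ^ α a ^ 2 (Ψ |x| + Ψ |z|)` (`ClassA.exists_smoothing`).
If `z` is a martingale increment with `E Ψ |z| ≤ 1`, the first-order term has mean zero, so that
adding `a z` multiplies `E F + 1` by at most `1 + 8 ^ α a ^ 2`. Hence `E Ψ |∑ a_k z_k|` is bounded
in terms of `α` alone when `∑ a_k ^ 2 ≤ 1` (`ClassA.integral_sum_martingaleDiff_le`), and convexity
turns this into a bound of the Orlicz norm by a constant.

For a fixed lag `j` the variables `P_{k-j}(Y_k)` are such martingale increments, of norm at most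
`p_j`. Since `Ψ` dominates a multiple of the square at infinity, `∑ p_j < ∞` makes
`∑_j P_{k-j}(Y_k)` absolutely convergent in `L¹`; with upward martingale convergence at `+∞` and
regularity at `-∞`, its sum is almost surely `Y_k` (`IsRegular.ae_hasSum_proj`). Summing over the
lags by convexity of `Ψ` and passing to the limit by Fatou's lemma bounds every finite sum
`∑_{k ∈ G} c_k Y_k` (`ClassA.lintegral_finset_sum_le_one`). The corresponding `L²` bound gives the
Cauchy criterion for unconditional convergence, and Fatou's lemma carries the Orlicz bound over to
the `L²` sum.
-/

namespace OrliczMoment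

/-! ### Pointwise estimates for Orlicz functions -/

section Pointwise

variable {α : ℝ} {Ψ : ℝ → ℝ}

lemma ClassA.continuous_abs (h : ClassA α Ψ) : Continuous fun x : ℝ => Ψ |x| :=
  h.continuousOn.comp_continuous _root_.continuous_abs fun x => abs_nonneg x

lemma ClassA.apply_two_mul_le (h : ClassA α Ψ) {x : ℝ} (hx : 0 ≤ x) :
    Ψ (2 * x) ≤ 2 ^ α * Ψ x :=
  h.growth 2 x le_rfl hx

lemma ClassA.apply_abs_add_le (h : ClassA α Ψ) (x y : ℝ) :
    Ψ |x + y| ≤ 2 ^ α * (Ψ |x| + Ψ |y|) := by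
  have hA : (0 : ℝ) < 2 ^ α := by positivity
  have hx := h.nonneg _ (abs_nonneg x)
  have hy := h.nonneg _ (abs_nonneg y)
  have hxy := abs_add_le x y
  rcases le_total |x| |y| with hle | hle
  · have := h.monotoneOn (abs_nonneg (x + y)) (by positivity : (0 : ℝ) ≤ 2 * |y|) (by linarith)
    nlinarith [h.apply_two_mul_le (abs_nonneg y)]
  · have := h.monotoneOn (abs_nonneg (x + y)) (by positivity : (0 : ℝ) ≤ 2 * |x|) (by linarith)
    nlinarith [h.apply_two_mul_le (abs_nonneg x)]

/-- Convexity of `x ↦ Ψ (√x)` and `Ψ 0 = 0` make `Ψ x / x ^ 2` nondecreasing. -/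
lemma ClassA.apply_mul_le_sq (h : ClassA α Ψ)
    (hsq : ConvexOn ℝ (Set.Ici 0) fun x : ℝ => Ψ (Real.sqrt x)) {t y : ℝ} (ht0 : 0 ≤ t)
    (ht1 : t ≤ 1) (hy : 0 ≤ y) : Ψ (t * y) ≤ t ^ 2 * Ψ y := by
  have := hsq.2 (Set.mem_Ici.2 (sq_nonneg y)) (Set.mem_Ici.2 le_rfl) (sq_nonneg t)
    (by nlinarith : (0 : ℝ) ≤ 1 - t ^ 2) (by ring)
  simpa [← mul_pow, Real.sqrt_sq, hy, mul_nonneg ht0 hy, h.map_zero] using this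

lemma ClassA.apply_mul_le (h : ClassA α Ψ) (hconv : ConvexOn ℝ (Set.Ici 0) Ψ) {t y : ℝ}
    (ht0 : 0 ≤ t) (ht1 : t ≤ 1) (hy : 0 ≤ y) : Ψ (t * y) ≤ t * Ψ y := by
  have := hconv.2 (Set.mem_Ici.2 hy) (Set.mem_Ici.2 le_rfl) ht0
    (by linarith : (0 : ℝ) ≤ 1 - t) (by ring)
  simpa [h.map_zero] using this

lemma ClassA.mul_sq_le (h : ClassA α Ψ)
    (hsq : ConvexOn ℝ (Set.Ici 0) fun x : ℝ => Ψ (Real.sqrt x)) {x y : ℝ} (hx : 0 ≤ x)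
    (hxy : x ≤ y) : Ψ x * y ^ 2 ≤ Ψ y * x ^ 2 := by
  rcases (hx.trans hxy).eq_or_lt with h0 | h0
  · have : x = 0 := by linarith
    simp [this, ← h0]
  have := h.apply_mul_le_sq hsq (div_nonneg hx h0.le) ((div_le_one h0).2 hxy) h0.le
  rw [div_mul_cancel₀ _ h0.ne', div_pow] at this
  calc Ψ x * y ^ 2 ≤ x ^ 2 / y ^ 2 * Ψ y * y ^ 2 := by gcongr
    _ = Ψ y * x ^ 2 := by field_simp

lemma ClassA.mul_le (h : ClassA α Ψ) (hconv : ConvexOn ℝ (Set.Ici 0) Ψ) {x y : ℝ} (hx : 0 ≤ x)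
    (hxy : x ≤ y) : Ψ x * y ≤ Ψ y * x := by
  rcases (hx.trans hxy).eq_or_lt with h0 | h0
  · have : x = 0 := by linarith
    simp [this, ← h0]
  have := h.apply_mul_le hconv (div_nonneg hx h0.le) ((div_le_one h0).2 hxy) h0.le
  rw [div_mul_cancel₀ _ h0.ne'] at this
  calc Ψ x * y ≤ x / y * Ψ y * y := by gcongr
    _ = Ψ y * x := by field_simp

/-- The odd function `x ↦ Ψ |x| / x`, with value `0` at `0`. Its primitive is a differentiable
convex function comparable to `x ↦ Ψ |x|`. -/
noncomputable def slope (Ψ : ℝ → ℝ) (x : ℝ) : ℝ := Ψ |x| / x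

lemma slope_zero : slope Ψ 0 = 0 := by simp [slope]

lemma slope_neg (x : ℝ) : slope Ψ (-x) = -slope Ψ x := by simp [slope, div_neg]

lemma slope_of_nonneg {x : ℝ} (hx : 0 ≤ x) : slope Ψ x = Ψ x / x := by
  rw [slope, abs_of_nonneg hx]

lemma ClassA.slope_mul_self (h : ClassA α Ψ) (x : ℝ) : slope Ψ x * x = Ψ |x| := by
  rcases eq_or_ne x 0 with rfl | hx
  · simp [h.map_zero]
  · rw [slope, div_mul_cancel₀ _ hx]

lemma ClassA.slope_nonneg (h : ClassA α Ψ) {x : ℝ} (hx : 0 ≤ x) : 0 ≤ slope Ψ x :=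
  div_nonneg (h.nonneg _ (abs_nonneg x)) hx

lemma ClassA.abs_slope (h : ClassA α Ψ) (x : ℝ) : |slope Ψ x| = slope Ψ |x| := by
  rw [slope, slope, abs_div, abs_abs, abs_of_nonneg (h.nonneg _ (abs_nonneg x))]

lemma ClassA.slope_le_slope (h : ClassA α Ψ) (hconv : ConvexOn ℝ (Set.Ici 0) Ψ) {x y : ℝ}
    (hx : 0 ≤ x) (hxy : x ≤ y) : slope Ψ x ≤ slope Ψ y := by
  rcases hx.eq_or_lt with rfl | hx0
  · simpa [slope_zero] using h.slope_nonneg hxy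
  · rw [slope_of_nonneg hx, slope_of_nonneg (hx.trans hxy),
      div_le_div_iff₀ hx0 (hx0.trans_le hxy)]
    exact h.mul_le hconv hx hxy

lemma ClassA.monotone_slope (h : ClassA α Ψ) (hconv : ConvexOn ℝ (Set.Ici 0) Ψ) :
    Monotone (slope Ψ) := by
  intro x y hxy
  rcases le_total 0 x with hx | hx
  · exact h.slope_le_slope hconv hx hxy
  rcases le_total 0 y with hy | hy
  · have := h.slope_nonneg (neg_nonneg.2 hx)
    rw [slope_neg] at this
    linarith [h.slope_nonneg hy]
  · have := h.slope_le_slope hconv (neg_nonneg.2 hy) (neg_le_neg hxy)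
    rw [slope_neg, slope_neg] at this
    linarith

/-- `slope Ψ` grows at most like a linear function of slope `Ψ R / R ^ 2` on `[0, R]`. -/
lemma ClassA.slope_le_mul (h : ClassA α Ψ)
    (hsq : ConvexOn ℝ (Set.Ici 0) fun x : ℝ => Ψ (Real.sqrt x)) {x R : ℝ}
    (hx : 0 ≤ x) (hR : 0 < R) (hxR : x ≤ R) : slope Ψ x ≤ x * (Ψ R / R ^ 2) := by
  rcases hx.eq_or_lt with rfl | hx0
  · simp [slope_zero]
  rw [slope_of_nonneg hx, div_le_iff₀ hx0, ← mul_div_assoc, div_mul_eq_mul_div,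
    le_div_iff₀ (by positivity)]
  linarith [h.mul_sq_le hsq hx hxR]

/-- On `[0, R]` the function `slope Ψ` is Lipschitz: the slopes of the convex function `Ψ` on
`[x, y]` are dominated by its slope on `[y, 2 y]`, which the growth condition controls. -/
lemma ClassA.slope_sub_le_of_nonneg (h : ClassA α Ψ) (hconv : ConvexOn ℝ (Set.Ici 0) Ψ)
    (hsq : ConvexOn ℝ (Set.Ici 0) fun x : ℝ => Ψ (Real.sqrt x)) {x y R : ℝ}
    (hx : 0 ≤ x) (hxy : x ≤ y) (hR : 0 < R) (hyR : y ≤ R) :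
    slope Ψ y - slope Ψ x ≤ 2 ^ α * ((y - x) * (Ψ R / R ^ 2)) := by
  have hA : (0 : ℝ) < 2 ^ α := by positivity
  rcases hxy.eq_or_lt with rfl | hlt
  · simp
  have hy : 0 < y := hx.trans_lt hlt
  have hq := h.slope_le_mul hsq hy.le hR hyR
  have h1 : slope Ψ y - slope Ψ x ≤ (Ψ y - Ψ x) / y := by
    rw [sub_div, slope_of_nonneg hy.le, slope_of_nonneg hx]
    rcases hx.eq_or_lt with rfl | hx0
    · simp [h.map_zero]
    · have := div_le_div_of_nonneg_left (h.nonneg x hx) hx0 hxy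
      linarith
  have h2 : (Ψ y - Ψ x) / (y - x) ≤ (Ψ (2 * y) - Ψ y) / (2 * y - y) :=
    hconv.slope_mono_adjacent (Set.mem_Ici.2 hx) (Set.mem_Ici.2 (by positivity)) hlt
      (by linarith)
  have h3 : (Ψ (2 * y) - Ψ y) / (2 * y - y) ≤ 2 ^ α * slope Ψ y := by
    rw [slope_of_nonneg hy.le, show 2 * y - y = y by ring, ← mul_div_assoc]
    gcongr
    linarith [h.apply_two_mul_le hy.le, h.nonneg y hy.le]
  have h4 : Ψ y - Ψ x ≤ 2 ^ α * slope Ψ y * (y - x) := by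
    rw [← div_le_iff₀ (sub_pos.2 hlt)]
    exact h2.trans h3
  calc slope Ψ y - slope Ψ x ≤ (Ψ y - Ψ x) / y := h1
    _ ≤ 2 ^ α * slope Ψ y * (y - x) / y := by gcongr
    _ ≤ 2 ^ α * (y * (Ψ R / R ^ 2)) * (y - x) / y := by
        have := sub_pos.2 hlt
        gcongr
    _ = _ := by field_simp

lemma ClassA.slope_sub_le (h : ClassA α Ψ) (hα : 0 < α) (hconv : ConvexOn ℝ (Set.Ici 0) Ψ)
    (hsq : ConvexOn ℝ (Set.Ici 0) fun x : ℝ => Ψ (Real.sqrt x)) {x y R : ℝ}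
    (hxy : x ≤ y) (hR : 0 < R) (hxR : |x| ≤ R) (hyR : |y| ≤ R) :
    slope Ψ y - slope Ψ x ≤ 2 ^ α * ((y - x) * (Ψ R / R ^ 2)) := by
  obtain ⟨hx1, hx2⟩ := abs_le.1 hxR
  obtain ⟨hy1, hy2⟩ := abs_le.1 hyR
  have hA : (1 : ℝ) ≤ 2 ^ α := Real.one_le_rpow (by norm_num) hα.le
  rcases le_total 0 x with hx | hx
  · exact h.slope_sub_le_of_nonneg hconv hsq hx hxy hR hy2
  rcases le_total 0 y with hy | hy
  · have h1 := h.slope_le_mul hsq hy hR hy2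
    have h2 := h.slope_le_mul hsq (neg_nonneg.2 hx) hR (by linarith)
    rw [slope_neg] at h2
    have h3 : 0 ≤ (y - x) * (Ψ R / R ^ 2) :=
      mul_nonneg (by linarith) (div_nonneg (h.nonneg R hR.le) (by positivity))
    nlinarith
  · have := h.slope_sub_le_of_nonneg hconv hsq (neg_nonneg.2 hy) (neg_le_neg hxy) hR
      (by linarith)
    rw [slope_neg, slope_neg] at this
    linarith

/-- Young-type inequality for the first-order term. -/
lemma ClassA.abs_slope_mul_le (h : ClassA α Ψ) (hconv : ConvexOn ℝ (Set.Ici 0) Ψ) (x z : ℝ) :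
    |slope Ψ x * z| ≤ Ψ |x| + Ψ |z| := by
  have hx := h.nonneg _ (abs_nonneg x)
  have hz := h.nonneg _ (abs_nonneg z)
  have h0 := h.slope_nonneg (abs_nonneg x)
  rw [abs_mul, h.abs_slope]
  rcases le_total |z| |x| with hle | hle
  · have := mul_le_mul_of_nonneg_left hle h0
    have h1 := h.slope_mul_self |x|
    rw [abs_abs] at h1
    linarith
  · have := mul_le_mul_of_nonneg_right (h.slope_le_slope hconv (abs_nonneg x) hle)
      (abs_nonneg z)
    have h1 := h.slope_mul_self |z|
    rw [abs_abs] at h1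
    linarith

/-- Control of the second-order term for an increment `a * z` with `|a| ≤ 1`. -/
lemma ClassA.sq_mul_div_le (h : ClassA α Ψ)
    (hsq : ConvexOn ℝ (Set.Ici 0) fun x : ℝ => Ψ (Real.sqrt x)) {a : ℝ} (ha : |a| ≤ 1)
    (x z : ℝ) (hR : 0 < |x| + |a * z|) :
    (a * z) ^ 2 * (Ψ (|x| + |a * z|) / (|x| + |a * z|) ^ 2) ≤
      2 ^ α * (a ^ 2 * (Ψ |x| + Ψ |z|)) := by
  have hA : (0 : ℝ) < 2 ^ α := by positivity
  have hx := h.nonneg _ (abs_nonneg x)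
  have hz := h.nonneg _ (abs_nonneg z)
  set R := |x| + |a * z| with hRdef
  -- `Ψ R / R ^ 2` is at most `2 ^ α` times the same quotient at the larger of the two summands.
  have key : ∀ y : ℝ, 0 < y → y ≤ R → R ≤ 2 * y → Ψ R / R ^ 2 ≤ 2 ^ α * (Ψ y / y ^ 2) := by
    intro y hy hyR hR2
    have h1 : Ψ R ≤ Ψ (2 * y) := h.monotoneOn hR.le (by positivity : (0 : ℝ) ≤ 2 * y) hR2
    calc Ψ R / R ^ 2 ≤ 2 ^ α * Ψ y / y ^ 2 := by
          have := h.nonneg y hy.le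
          have h2 := h1.trans (h.apply_two_mul_le hy.le)
          gcongr
      _ = _ := by ring
  rcases le_total |a * z| |x| with hle | hle
  · have hx0 : 0 < |x| := by
      by_contra hc
      linarith
    have h2 : z ^ 2 * (Ψ |x| / |x| ^ 2) ≤ Ψ |x| + Ψ |z| := by
      rw [← sq_abs z, ← mul_div_assoc, div_le_iff₀ (by positivity)]
      rcases le_total |z| |x| with hzx | hzx
      · nlinarith [mul_le_mul_of_nonneg_left (pow_le_pow_left₀ (abs_nonneg z) hzx 2) hx,
          mul_nonneg hz (sq_nonneg |x|)]
      · nlinarith [h.mul_sq_le hsq (abs_nonneg x) hzx, mul_nonneg hx (sq_nonneg |x|)]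
    calc (a * z) ^ 2 * (Ψ R / R ^ 2) ≤ (a * z) ^ 2 * (2 ^ α * (Ψ |x| / |x| ^ 2)) := by
          gcongr
          exact key _ hx0 (by linarith [abs_nonneg (a * z)]) (by linarith)
      _ = 2 ^ α * (a ^ 2 * (z ^ 2 * (Ψ |x| / |x| ^ 2))) := by ring
      _ ≤ _ := by gcongr
  · have hd0 : 0 < |a * z| := by
      by_contra hc
      linarith
    have h2 : Ψ |a * z| ≤ a ^ 2 * Ψ |z| := by
      rw [abs_mul, ← sq_abs a]
      exact h.apply_mul_le_sq hsq (abs_nonneg a) ha (abs_nonneg z)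
    calc (a * z) ^ 2 * (Ψ R / R ^ 2)
        ≤ (a * z) ^ 2 * (2 ^ α * (Ψ |a * z| / |a * z| ^ 2)) := by
          gcongr
          exact key _ hd0 (by linarith [abs_nonneg x]) (by linarith)
      _ = 2 ^ α * Ψ |a * z| := by
          rw [← sq_abs (a * z)]
          field_simp
      _ ≤ 2 ^ α * (a ^ 2 * (Ψ |x| + Ψ |z|)) := by
          gcongr
          nlinarith [mul_nonneg (sq_nonneg a) hx]

end Pointwise

/-- A monotone function on the line is a subgradient of its (continuous) primitive. -/
lemma exists_primitive_of_monotone {f : ℝ → ℝ} (hf : Monotone f) :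
    ∃ F : ℝ → ℝ, Continuous F ∧ F 0 = 0 ∧ ∀ x y, f x * (y - x) ≤ F y - F x := by
  have hint : ∀ a b, IntervalIntegrable f volume a b := fun a b => hf.intervalIntegrable
  refine ⟨fun x => ∫ t in (0 : ℝ)..x, f t, intervalIntegral.continuous_primitive hint 0,
    by simp, fun x y => ?_⟩
  rw [intervalIntegral.integral_interval_sub_left (hint 0 y) (hint 0 x)]
  rcases le_total x y with hxy | hxy
  · have := intervalIntegral.integral_mono_on (f := fun _ => f x) hxy (by simp) (hint x y)
      fun t ht => hf ht.1
    rw [intervalIntegral.integral_const, smul_eq_mul] at this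
    linarith
  · have := intervalIntegral.integral_mono_on (g := fun _ => f x) hxy (hint y x) (by simp)
      fun t ht => hf ht.2
    rw [intervalIntegral.integral_const, smul_eq_mul] at this
    rw [intervalIntegral.integral_symm]
    linarith

/-- Smoothing: `x ↦ Ψ |x|`, which may have kinks, is comparable to a function `F` satisfying a
second-order Taylor inequality with remainder adapted to `Ψ`. -/
lemma ClassA.exists_smoothing {α : ℝ} {Ψ : ℝ → ℝ} (h : ClassA α Ψ) (hα : 0 < α)
    (hconv : ConvexOn ℝ (Set.Ici 0) Ψ)
    (hsq : ConvexOn ℝ (Set.Ici 0) fun x : ℝ => Ψ (Real.sqrt x)) :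
    ∃ F : ℝ → ℝ, Continuous F ∧ F 0 = 0 ∧ (∀ x, 0 ≤ F x) ∧ (∀ x, F x ≤ Ψ |x|) ∧
      (∀ x, Ψ |x| ≤ 2 ^ α * F x) ∧
      ∀ a x z, |a| ≤ 1 → F (x + a * z) ≤ F x + a * (slope Ψ x * z) +
        (2 ^ α) ^ 2 * (a ^ 2 * (Ψ |x| + Ψ |z|)) := by
  obtain ⟨F, hFc, hF0, hF⟩ := exists_primitive_of_monotone (h.monotone_slope hconv)
  have hA : (0 : ℝ) < 2 ^ α := by positivity
  have hFnn : ∀ x, 0 ≤ F x := fun x => by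
    have := hF 0 x
    rw [slope_zero, hF0] at this
    linarith
  refine ⟨F, hFc, hF0, hFnn, fun x => ?_, fun x => ?_, fun a x z ha => ?_⟩
  · have := hF x 0
    rw [hF0] at this
    linarith [h.slope_mul_self x]
  · have h1 := hF (x / 2) x
    have h2 := h.slope_mul_self (x / 2)
    rw [show x - x / 2 = x / 2 by ring, h2] at h1
    have h3 := h.apply_two_mul_le (abs_nonneg (x / 2))
    rw [show 2 * |x / 2| = |x| by rw [abs_div, abs_two]; ring] at h3
    nlinarith [hFnn (x / 2)]
  · have h1 := hF (x + a * z) x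
    suffices (slope Ψ (x + a * z) - slope Ψ x) * (a * z) ≤
        (2 ^ α) ^ 2 * (a ^ 2 * (Ψ |x| + Ψ |z|)) by linarith
    have hR0 : 0 ≤ |x| + |a * z| := by positivity
    rcases hR0.eq_or_lt with hR | hR
    · have : a * z = 0 := abs_eq_zero.1 (by linarith [abs_nonneg x, abs_nonneg (a * z)])
      rw [this, mul_zero]
      have hx := h.nonneg _ (abs_nonneg x)
      have hz := h.nonneg _ (abs_nonneg z)
      positivity
    have h2 : (slope Ψ (x + a * z) - slope Ψ x) * (a * z) ≤
        2 ^ α * ((a * z) ^ 2 * (Ψ (|x| + |a * z|) / (|x| + |a * z|) ^ 2)) := by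
      have hx' : |x| ≤ |x| + |a * z| := by linarith [abs_nonneg (a * z)]
      have hy' : |x + a * z| ≤ |x| + |a * z| := abs_add_le _ _
      rcases le_total 0 (a * z) with hd | hd
      · have := h.slope_sub_le hα hconv hsq (by linarith : x ≤ x + a * z) hR hx' hy'
        nlinarith
      · have := h.slope_sub_le hα hconv hsq (by linarith : x + a * z ≤ x) hR hy' hx'
        nlinarith
    calc _ ≤ _ := h2
      _ ≤ 2 ^ α * (2 ^ α * (a ^ 2 * (Ψ |x| + Ψ |z|))) := by
        exact mul_le_mul_of_nonneg_left (h.sq_mul_div_le hsq ha x z hR) hA.le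
      _ = _ := by ring

/-! ### Martingale differences with bounded Orlicz modular -/

section Martingale

variable {Ω : Type*} {mΩ : MeasurableSpace Ω} {μ : Measure Ω} {α : ℝ} {Ψ : ℝ → ℝ}

lemma ClassA.integrable_of_lintegral_le (h : ClassA α Ψ) {X : Ω → ℝ}
    (hX : AEStronglyMeasurable X μ) (hle : ∫⁻ ω, ENNReal.ofReal (Ψ |X ω|) ∂μ ≤ 1) :
    Integrable (fun ω => Ψ |X ω|) μ ∧ ∫ ω, Ψ |X ω| ∂μ ≤ 1 := by
  have hm : AEStronglyMeasurable (fun ω => Ψ |X ω|) μ :=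
    h.continuous_abs.comp_aestronglyMeasurable hX
  have hnn : 0 ≤ᵐ[μ] fun ω => Ψ |X ω| := Eventually.of_forall fun ω => h.nonneg _ (abs_nonneg _)
  refine ⟨⟨hm, ?_⟩, ?_⟩
  · rw [hasFiniteIntegral_iff_ofReal hnn]
    exact hle.trans_lt ENNReal.one_lt_top
  · rw [integral_eq_lintegral_of_nonneg_ae hnn hm]
    exact ENNReal.toReal_le_of_le_ofReal zero_le_one (by simpa using hle)

/-- If `M` is `m`-measurable and `E(z | m) = 0`, the first-order term `E (slope Ψ M * z)`
vanishes. -/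
lemma ClassA.integral_slope_mul_eq_zero (h : ClassA α Ψ) (hconv : ConvexOn ℝ (Set.Ici 0) Ψ)
    {m : MeasurableSpace Ω} (hm : m ≤ mΩ) [SigmaFinite (μ.trim hm)] {M z : Ω → ℝ}
    (hM : StronglyMeasurable[m] M)
    (hz : Integrable z μ) (hz0 : μ[z | m] =ᵐ[μ] 0) (hΨM : Integrable (fun ω => Ψ |M ω|) μ)
    (hΨz : Integrable (fun ω => Ψ |z ω|) μ) :
    Integrable (fun ω => slope Ψ (M ω) * z ω) μ ∧ ∫ ω, slope Ψ (M ω) * z ω ∂μ = 0 := by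
  have hsl : StronglyMeasurable[m] fun ω => slope Ψ (M ω) :=
    ((h.monotone_slope hconv).measurable.comp hM.measurable).stronglyMeasurable
  have hint : Integrable (fun ω => slope Ψ (M ω) * z ω) μ :=
    (hΨM.add hΨz).mono' ((hsl.mono hm).aestronglyMeasurable.mul hz.aestronglyMeasurable)
      (Eventually.of_forall fun ω => h.abs_slope_mul_le hconv _ _)
  refine ⟨hint, ?_⟩
  have hpull := condExp_mul_of_stronglyMeasurable_left (μ := μ) hsl hint hz
  rw [← integral_condExp hm]
  refine integral_eq_zero_of_ae ?_
  filter_upwards [hpull, hz0] with ω h1 h2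
  change (μ[(fun ω => slope Ψ (M ω)) * z | m]) ω = 0
  rw [h1, Pi.mul_apply, h2, Pi.zero_apply, mul_zero]

/-- Gronwall argument: each martingale increment `a k * z k` multiplies `E F(M) + 1` by at most
`1 + C * a k ^ 2`, where `F` is the smoothing of `Ψ`. -/
lemma ClassA.integral_sum_martingaleDiff_le [IsProbabilityMeasure μ] (h : ClassA α Ψ)
    (hα : 0 < α) (hconv : ConvexOn ℝ (Set.Ici 0) Ψ)
    (hsq : ConvexOn ℝ (Set.Ici 0) fun x : ℝ => Ψ (Real.sqrt x)) (G : ℤ → MeasurableSpace Ω)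
    (hG : Monotone G) (hGle : ∀ k, G k ≤ mΩ) {z : ℤ → Ω → ℝ} {a : ℤ → ℝ}
    (hzm : ∀ k, StronglyMeasurable[G k] (z k)) (hz : ∀ k, Integrable (z k) μ)
    (hz0 : ∀ k, μ[z k | G (k - 1)] =ᵐ[μ] 0) (hΨz : ∀ k, Integrable (fun ω => Ψ |z k ω|) μ)
    (hΨz1 : ∀ k, ∫ ω, Ψ |z k ω| ∂μ ≤ 1) (s : Finset ℤ) (ha : ∑ k ∈ s, a k ^ 2 ≤ 1) :
    Integrable (fun ω => Ψ |∑ k ∈ s, a k * z k ω|) μ ∧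
      ∫ ω, Ψ |∑ k ∈ s, a k * z k ω| ∂μ ≤ 2 ^ α * Real.exp ((2 ^ α) ^ 3) := by
  obtain ⟨F, hFc, hF0, hFnn, hFle, hleF, hT⟩ := h.exists_smoothing hα hconv hsq
  have hA : (1 : ℝ) ≤ 2 ^ α := Real.one_le_rpow (by norm_num) hα.le
  set A : ℝ := 2 ^ α
  have hFint : ∀ X : Ω → ℝ, AEStronglyMeasurable X μ → Integrable (fun ω => Ψ |X ω|) μ →
      Integrable (fun ω => F (X ω)) μ := fun X hX hΨX =>
    hΨX.mono' (hFc.comp_aestronglyMeasurable hX)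
      (Eventually.of_forall fun ω => by
        rw [Real.norm_of_nonneg (hFnn _)]
        exact hFle _)
  have hMm : ∀ s : Finset ℤ, AEStronglyMeasurable (fun ω => ∑ k ∈ s, a k * z k ω) μ := fun s =>
    Finset.aestronglyMeasurable_fun_sum s fun k _ =>
      ((hz k).const_mul (a k)).aestronglyMeasurable
  have main : ∀ s : Finset ℤ, (∀ k ∈ s, |a k| ≤ 1) →
      Integrable (fun ω => Ψ |∑ k ∈ s, a k * z k ω|) μ ∧
      ∫ ω, F (∑ k ∈ s, a k * z k ω) ∂μ + 1 ≤ Real.exp (A ^ 3 * ∑ k ∈ s, a k ^ 2) := by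
    intro s
    induction s using Finset.induction_on_max with
    | empty => simp [h.map_zero, hF0]
    | insert n s hmax ih =>
      intro has
      obtain ⟨hi, hle⟩ := ih fun k hk => has k (Finset.mem_insert_of_mem hk)
      have han := has n (Finset.mem_insert_self n s)
      have hns : n ∉ s := fun hn => lt_irrefl _ (hmax n hn)
      set M : Ω → ℝ := fun ω => ∑ k ∈ s, a k * z k ω with hM
      have hsum : ∀ ω, ∑ k ∈ insert n s, a k * z k ω = M ω + a n * z n ω := fun ω => by
        rw [Finset.sum_insert hns, add_comm]
      simp only [hsum]
      have hMsm : StronglyMeasurable[G (n - 1)] M := by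
        refine Finset.stronglyMeasurable_fun_sum s fun k hk => ?_
        exact ((hzm k).mono (hG (by have := hmax k hk; omega))).const_mul (a k)
      have hΨan : Integrable (fun ω => Ψ |a n * z n ω|) μ := by
        refine (hΨz n).mono' (h.continuous_abs.comp_aestronglyMeasurable
          ((hz n).const_mul (a n)).aestronglyMeasurable) (Eventually.of_forall fun ω => ?_)
        rw [Real.norm_of_nonneg (h.nonneg _ (abs_nonneg _))]
        refine h.monotoneOn (Set.mem_Ici.2 (abs_nonneg _)) (Set.mem_Ici.2 (abs_nonneg _)) ?_
        rw [abs_mul]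
        exact mul_le_of_le_one_left (abs_nonneg _) han
      have hMn : AEStronglyMeasurable (fun ω => M ω + a n * z n ω) μ :=
        (hMm s).add ((hz n).const_mul (a n)).aestronglyMeasurable
      have hi' : Integrable (fun ω => Ψ |M ω + a n * z n ω|) μ := by
        refine ((hi.add hΨan).const_mul A).mono'
          (h.continuous_abs.comp_aestronglyMeasurable hMn) (Eventually.of_forall fun ω => ?_)
        rw [Real.norm_of_nonneg (h.nonneg _ (abs_nonneg _))]
        exact h.apply_abs_add_le _ _
      refine ⟨hi', ?_⟩
      obtain ⟨hsi, hs0⟩ := h.integral_slope_mul_eq_zero hconv (hGle (n - 1)) hMsm (hz n) (hz0 n)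
        hi (hΨz n)
      have hFM := hFint M (hMm s) hi
      have h1 : ∫ ω, F (M ω + a n * z n ω) ∂μ ≤ ∫ ω, F (M ω) ∂μ +
          A ^ 2 * (a n ^ 2 * (∫ ω, Ψ |M ω| ∂μ + ∫ ω, Ψ |z n ω| ∂μ)) := by
        have e2 : Integrable (fun ω => A ^ 2 * (a n ^ 2 * (Ψ |M ω| + Ψ |z n ω|))) μ :=
          ((hi.add (hΨz n)).const_mul _).const_mul _
        have e3 : Integrable (fun ω => a n * (slope Ψ (M ω) * z n ω)) μ := hsi.const_mul _
        have e4 : Integrable (fun ω => F (M ω) + a n * (slope Ψ (M ω) * z n ω)) μ := hFM.add e3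
        have := integral_mono (hFint _ hMn hi') (e4.add e2) fun ω => hT (a n) (M ω) (z n ω) han
        simp only [Pi.add_apply] at this
        rwa [integral_add e4 e2, integral_add hFM e3, integral_const_mul, integral_const_mul,
          integral_const_mul, integral_add hi (hΨz n), hs0, mul_zero, add_zero] at this
      have h2 : ∫ ω, Ψ |M ω| ∂μ ≤ A * ∫ ω, F (M ω) ∂μ := by
        rw [← integral_const_mul]
        exact integral_mono hi (hFM.const_mul _) fun ω => hleF _
      have h3 : 0 ≤ ∫ ω, F (M ω) ∂μ := integral_nonneg fun ω => hFnn _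
      have h4 : ∫ ω, Ψ |M ω| ∂μ + ∫ ω, Ψ |z n ω| ∂μ ≤ A * (∫ ω, F (M ω) ∂μ + 1) := by
        linarith [hΨz1 n]
      rw [Finset.sum_insert hns]
      calc ∫ ω, F (M ω + a n * z n ω) ∂μ + 1
          ≤ ∫ ω, F (M ω) ∂μ + A ^ 2 * (a n ^ 2 * (A * (∫ ω, F (M ω) ∂μ + 1))) + 1 := by
            have := mul_le_mul_of_nonneg_left h4 (by positivity : 0 ≤ A ^ 2 * a n ^ 2)
            linarith
        _ = (A ^ 3 * a n ^ 2 + 1) * (∫ ω, F (M ω) ∂μ + 1) := by ring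
        _ ≤ Real.exp (A ^ 3 * a n ^ 2) * Real.exp (A ^ 3 * ∑ k ∈ s, a k ^ 2) := by
            gcongr
            exact Real.add_one_le_exp _
        _ = _ := by rw [← Real.exp_add, mul_add]
  obtain ⟨hi, hle⟩ := main s fun k hk => by
    rw [← sq_le_one_iff_abs_le_one]
    exact (Finset.single_le_sum (fun i _ => sq_nonneg (a i)) hk).trans ha
  refine ⟨hi, ?_⟩
  calc ∫ ω, Ψ |∑ k ∈ s, a k * z k ω| ∂μ ≤ A * ∫ ω, F (∑ k ∈ s, a k * z k ω) ∂μ := by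
        rw [← integral_const_mul]
        exact integral_mono hi ((hFint _ (hMm s) hi).const_mul _) fun ω => hleF _
    _ ≤ A * Real.exp (A ^ 3) := by
        gcongr
        refine (by linarith : _ ≤ _).trans (hle.trans ?_)
        gcongr
        exact mul_le_of_le_one_right (by positivity) ha

/-- The constant `2 ^ α * exp (8 ^ α)` of the moment inequality. -/
noncomputable def momentConst (α : ℝ) : ℝ := 2 ^ α * Real.exp ((2 ^ α) ^ 3)

lemma momentConst_pos (α : ℝ) : 0 < momentConst α := by
  unfold momentConst
  positivity

lemma one_le_momentConst (hα : 0 < α) : 1 ≤ momentConst α :=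
  one_le_mul_of_one_le_of_one_le (Real.one_le_rpow (by norm_num) hα.le)
    (Real.one_le_exp (by positivity))

/-- Martingale type 2 of the Orlicz space of `Ψ`, in terms of modulars. -/
lemma ClassA.lintegral_sum_martingaleDiff_le_one [IsProbabilityMeasure μ] (h : ClassA α Ψ)
    (hα : 0 < α) (hconv : ConvexOn ℝ (Set.Ici 0) Ψ)
    (hsq : ConvexOn ℝ (Set.Ici 0) fun x : ℝ => Ψ (Real.sqrt x)) (G : ℤ → MeasurableSpace Ω)
    (hG : Monotone G) (hGle : ∀ k, G k ≤ mΩ) {z : ℤ → Ω → ℝ} {a : ℤ → ℝ}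
    (hzm : ∀ k, StronglyMeasurable[G k] (z k)) (hz : ∀ k, Integrable (z k) μ)
    (hz0 : ∀ k, μ[z k | G (k - 1)] =ᵐ[μ] 0)
    (hΨz : ∀ k, ∫⁻ ω, ENNReal.ofReal (Ψ |z k ω|) ∂μ ≤ 1)
    (s : Finset ℤ) (ha : ∑ k ∈ s, a k ^ 2 ≤ 1) :
    ∫⁻ ω, ENNReal.ofReal (Ψ (|∑ k ∈ s, a k * z k ω| / momentConst α)) ∂μ ≤ 1 := by
  have hz' := fun k => h.integrable_of_lintegral_le (hz k).aestronglyMeasurable (hΨz k)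
  obtain ⟨hi, hle⟩ := h.integral_sum_martingaleDiff_le hα hconv hsq G hG hGle hzm hz hz0
    (fun k => (hz' k).1) (fun k => (hz' k).2) s ha
  have hC := momentConst_pos α
  have hC1 := inv_le_one_of_one_le₀ (one_le_momentConst hα)
  calc ∫⁻ ω, ENNReal.ofReal (Ψ (|∑ k ∈ s, a k * z k ω| / momentConst α)) ∂μ
      ≤ ∫⁻ ω, ENNReal.ofReal ((momentConst α)⁻¹ * Ψ |∑ k ∈ s, a k * z k ω|) ∂μ := by
        refine lintegral_mono fun ω => ENNReal.ofReal_le_ofReal ?_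
        rw [div_eq_inv_mul]
        exact h.apply_mul_le hconv (inv_nonneg.2 hC.le) hC1 (abs_nonneg _)
    _ = ENNReal.ofReal (∫ ω, (momentConst α)⁻¹ * Ψ |∑ k ∈ s, a k * z k ω| ∂μ) := by
        rw [ofReal_integral_eq_lintegral_ofReal (hi.const_mul _)]
        exact Eventually.of_forall fun ω =>
          mul_nonneg (inv_nonneg.2 hC.le) (h.nonneg _ (abs_nonneg _))
    _ ≤ 1 := by
        rw [integral_const_mul, ENNReal.ofReal_le_one, inv_mul_le_iff₀ hC, mul_one]
        exact hle

end Martingale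

/-! ### The martingale decomposition of a regular random variable -/

section Decomposition

variable {Ω : Type*} {mΩ : MeasurableSpace Ω} {μ : Measure Ω}

lemma proj_apply (ℱ : Filtration ℤ mΩ) (j : ℤ) (Y : Ω → ℝ) (ω : Ω) :
    proj ℱ μ j Y ω = (μ[Y | ℱ j]) ω - (μ[Y | ℱ (j - 1)]) ω := rfl

lemma integrable_proj (ℱ : Filtration ℤ mΩ) (j : ℤ) (Y : Ω → ℝ) :
    Integrable (proj ℱ μ j Y) μ :=
  integrable_condExp.sub integrable_condExp

lemma stronglyMeasurable_proj (ℱ : Filtration ℤ mΩ) (j : ℤ) (Y : Ω → ℝ) :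
    StronglyMeasurable[ℱ j] (proj ℱ μ j Y) :=
  stronglyMeasurable_condExp.sub (stronglyMeasurable_condExp.mono (ℱ.mono (by omega)))

lemma condExp_proj [IsFiniteMeasure μ] (ℱ : Filtration ℤ mΩ) (j : ℤ) (Y : Ω → ℝ) :
    μ[proj ℱ μ j Y | ℱ (j - 1)] =ᵐ[μ] 0 := by
  have h1 := condExp_sub (μ := μ) (integrable_condExp (m := ℱ j) (f := Y))
    (integrable_condExp (m := ℱ (j - 1)) (f := Y)) (ℱ (j - 1))
  have h2 : μ[μ[Y | ℱ j] | ℱ (j - 1)] =ᵐ[μ] μ[Y | ℱ (j - 1)] :=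
    condExp_condExp_of_le (ℱ.mono (by omega)) (ℱ.le j)
  have h3 : μ[μ[Y | ℱ (j - 1)] | ℱ (j - 1)] = μ[Y | ℱ (j - 1)] :=
    condExp_of_stronglyMeasurable (ℱ.le _) stronglyMeasurable_condExp integrable_condExp
  filter_upwards [h1, h2] with ω h1 h2
  change (μ[μ[Y | ℱ j] - μ[Y | ℱ (j - 1)] | ℱ (j - 1)]) ω = 0
  rw [h1, Pi.sub_apply, h2, h3, sub_self]

/-- Upward convergence along `ℤ`. -/
lemma IsRegular.ae_tendsto_condExp_atTop [IsFiniteMeasure μ] {ℱ : Filtration ℤ mΩ} {Y : Ω → ℝ}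
    (hY : IsRegular ℱ μ Y) :
    ∀ᵐ ω ∂μ, Tendsto (fun n : ℕ => (μ[Y | ℱ ((n : ℤ) - 1)]) ω) atTop (𝓝 (Y ω)) := by
  let 𝒢 : Filtration ℕ mΩ :=
    ⟨fun n => ℱ ((n : ℤ) - 1), fun i j hij => ℱ.mono (by omega), fun n => ℱ.le _⟩
  have hsup : (⨆ k : ℤ, ℱ k) ≤ ⨆ n : ℕ, 𝒢 n := iSup_le fun k =>
    (ℱ.mono (by omega : k ≤ ((k + 1).toNat : ℤ) - 1)).trans (le_iSup (fun n => 𝒢 n) (k + 1).toNat)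
  exact hY.integrable.tendsto_ae_condExp (ℱ := 𝒢)
    (hY.measurable.mono hsup le_rfl).stronglyMeasurable

/-- An upper limit does not depend on the first `k` terms, hence is measurable with respect to
every member of a decreasing sequence of σ-algebras to which the sequence is adapted. -/
lemma measurable_iInf_limsup (m : ℕ → MeasurableSpace Ω) (hm : Antitone m) {X : ℕ → Ω → ℝ}
    (hX : ∀ n, Measurable[m n] (X n)) :
    Measurable[⨅ n, m n] fun ω => limsup (fun n => X n ω) atTop := by
  intro t ht
  refine MeasurableSpace.measurableSet_iInf.2 fun k => ?_
  have heq : (fun ω => limsup (fun n => X n ω) atTop) =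
      fun ω => limsup (fun n => X (n + k) ω) atTop :=
    funext fun ω => (limsup_nat_add (fun n => X n ω) k).symm
  rw [heq]
  have h : Measurable[m k] fun ω => limsup (fun n => X (n + k) ω) atTop := by
    refine @Measurable.limsup ℝ Ω _ _ _ (m k) _ _ _ _ fun n => ?_
    exact (hX (n + k)).mono (hm (by omega)) le_rfl
  exact h ht

/-- A dominated, almost surely convergent sequence adapted to a decreasing sequence of
σ-algebras tends to `0` if its members have zero conditional expectation given the intersection:
the limit is measurable with respect to the intersection. -/
lemma ae_tendsto_zero_of_condExp_iInf [IsFiniteMeasure μ] (m : ℕ → MeasurableSpace Ω)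
    (hm : Antitone m) (hle : ∀ n, m n ≤ mΩ) {E : ℕ → Ω → ℝ} (hE : ∀ n, Measurable[m n] (E n))
    (hEint : ∀ n, Integrable (E n) μ) (hlim : ∀ᵐ ω ∂μ, ∃ l, Tendsto (fun n => E n ω) atTop (𝓝 l))
    {g : Ω → ℝ} (hg : Integrable g μ) (hbound : ∀ n, ∀ᵐ ω ∂μ, ‖E n ω‖ ≤ g ω)
    (h0 : ∀ n, μ[E n | ⨅ n, m n] =ᵐ[μ] 0) :
    ∀ᵐ ω ∂μ, Tendsto (fun n => E n ω) atTop (𝓝 0) := by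
  obtain ⟨Z, hZm, hEZ⟩ : ∃ Z : Ω → ℝ, Measurable[⨅ n, m n] Z ∧
      ∀ᵐ ω ∂μ, Tendsto (fun n => E n ω) atTop (𝓝 (Z ω)) := by
    refine ⟨_, measurable_iInf_limsup m hm hE, ?_⟩
    filter_upwards [hlim] with ω ⟨l, hl⟩
    rwa [hl.limsup_eq]
  have hbot : (⨅ n, m n) ≤ mΩ := (iInf_le _ 0).trans (hle 0)
  have hZint : Integrable Z μ := by
    refine hg.mono' (hZm.mono hbot le_rfl).aestronglyMeasurable ?_
    filter_upwards [hEZ, ae_all_iff.2 hbound] with ω h1 h2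
    exact le_of_tendsto h1.norm (Eventually.of_forall h2)
  have h1 : μ[Z | ⨅ n, m n] =ᵐ[μ] μ[(0 : Ω → ℝ) | ⨅ n, m n] := by
    refine tendsto_condExp_unique E (fun _ => 0) Z 0 hEint
      (fun _ => integrable_zero _ _ _) hEZ (Eventually.of_forall fun ω => tendsto_const_nhds)
      g hg (fun _ => 0) (integrable_zero _ _ _) hbound (fun n => by simp) fun n => ?_
    rw [condExp_zero]
    exact h0 n
  rw [condExp_of_stronglyMeasurable hbot hZm.stronglyMeasurable hZint, condExp_zero] at h1
  filter_upwards [hEZ, h1] with ω h2 h3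
  rwa [h3] at h2

lemma sum_range_proj (ℱ : Filtration ℤ mΩ) (Y : Ω → ℝ) (n : ℕ) (ω : Ω) :
    ∑ i ∈ Finset.range n, proj ℱ μ (i : ℤ) Y ω =
      (μ[Y | ℱ ((n : ℤ) - 1)]) ω - (μ[Y | ℱ (-1)]) ω := by
  induction n with
  | zero => simp
  | succ n ih =>
    rw [Finset.sum_range_succ, ih, proj_apply, show (((n + 1 : ℕ) : ℤ) - 1) = n by push_cast; ring]
    ring

lemma sum_range_proj_neg (ℱ : Filtration ℤ mΩ) (Y : Ω → ℝ) (n : ℕ) (ω : Ω) :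
    ∑ i ∈ Finset.range n, proj ℱ μ (-((i : ℤ) + 1)) Y ω =
      (μ[Y | ℱ (-1)]) ω - (μ[Y | ℱ (-((n : ℤ) + 1))]) ω := by
  induction n with
  | zero => simp
  | succ n ih =>
    rw [Finset.sum_range_succ, ih, proj_apply,
      show -((n : ℤ) + 1) - 1 = -(((n + 1 : ℕ) : ℤ) + 1) by push_cast; ring]
    ring

lemma injective_neg_natCast_add_one : Function.Injective fun i : ℕ => -((i : ℤ) + 1) :=
  fun i j hij => by
    simp only at hij
    omega

/-- Downward convergence along `ℤ`. -/
lemma IsRegular.ae_tendsto_condExp_atBot [IsFiniteMeasure μ] {ℱ : Filtration ℤ mΩ} {Y : Ω → ℝ}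
    (hY : IsRegular ℱ μ Y) (hsum : ∑' j : ℤ, ∫⁻ ω, ‖proj ℱ μ j Y ω‖ₑ ∂μ ≠ ∞) :
    ∀ᵐ ω ∂μ, Tendsto (fun n : ℕ => (μ[Y | ℱ (-((n : ℤ) + 1))]) ω) atTop (𝓝 0) := by
  have hm : ∀ j, AEMeasurable (fun ω => ‖proj ℱ μ j Y ω‖ₑ) μ := fun j =>
    (integrable_proj ℱ j Y).aestronglyMeasurable.enorm
  rw [← lintegral_tsum hm] at hsum
  have hfin : ∀ᵐ ω ∂μ, ∑' j : ℤ, ‖proj ℱ μ j Y ω‖ₑ < ∞ := ae_lt_top' (AEMeasurable.tsum hm) hsum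
  have hgint : Integrable (fun ω => (∑' j : ℤ, ‖proj ℱ μ j Y ω‖ₑ).toReal) μ :=
    integrable_toReal_of_lintegral_ne_top (AEMeasurable.tsum hm) hsum
  have hint : ∀ j : ℤ, Integrable (μ[Y | ℱ j]) μ := fun j => integrable_condExp
  refine ae_tendsto_zero_of_condExp_iInf (fun n : ℕ => ℱ (-(n : ℤ)))
    (fun i j hij => ℱ.mono (by omega)) (fun n => ℱ.le _)
    (fun n => (stronglyMeasurable_condExp.mono (ℱ.mono (by omega))).measurable)
    (fun n => hint _) ?_ ((hint (-1)).norm.add hgint) (fun n => ?_) fun n => ?_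
  · filter_upwards [hfin] with ω hω
    have hs := (tsum_enorm_ne_top_iff_summable_norm.1 hω.ne).of_norm
    have h1 := (hs.comp_injective injective_neg_natCast_add_one).hasSum.tendsto_sum_nat
    simp only [Function.comp_apply, sum_range_proj_neg] at h1
    have h2 := (tendsto_const_nhds (x := (μ[Y | ℱ (-1)]) ω)).sub h1
    simp only [sub_sub_cancel] at h2
    exact ⟨_, h2⟩
  · filter_upwards [hfin] with ω hω
    have h1 : ‖(μ[Y | ℱ (-1)]) ω - (μ[Y | ℱ (-((n : ℤ) + 1))]) ω‖ₑ ≤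
        ∑' j : ℤ, ‖proj ℱ μ j Y ω‖ₑ := by
      rw [← sum_range_proj_neg]
      refine (enorm_sum_le _ _).trans ((ENNReal.sum_le_tsum _).trans ?_)
      exact ENNReal.tsum_comp_le_tsum_of_injective injective_neg_natCast_add_one
        fun j => ‖proj ℱ μ j Y ω‖ₑ
    have h2 := ENNReal.toReal_mono hω.ne h1
    rw [toReal_enorm] at h2
    have h3 := norm_sub_norm_le ((μ[Y | ℱ (-((n : ℤ) + 1))]) ω) ((μ[Y | ℱ (-1)]) ω)
    rw [norm_sub_rev] at h3
    rw [Pi.add_apply]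
    linarith
  · refine (condExp_condExp_of_le ?_ (ℱ.le _)).trans hY.condExp_bot
    exact (iInf_le _ (n + 1)).trans (ℱ.mono (by push_cast; omega))

/-- If the increments of the martingale `E(Y | ℱ_j)` are absolutely summable in `L¹`, a regular
`Y` is almost surely the sum of these increments. -/
lemma IsRegular.ae_hasSum_proj [IsFiniteMeasure μ] {ℱ : Filtration ℤ mΩ} {Y : Ω → ℝ}
    (hY : IsRegular ℱ μ Y) (hsum : ∑' j : ℤ, ∫⁻ ω, ‖proj ℱ μ j Y ω‖ₑ ∂μ ≠ ∞) :
    ∀ᵐ ω ∂μ, HasSum (fun j : ℤ => proj ℱ μ j Y ω) (Y ω) := by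
  have hs : ∀ᵐ ω ∂μ, Summable fun j : ℤ => ‖proj ℱ μ j Y ω‖ :=
    summable_norm_of_tsum_eLpNorm_ne_top le_rfl
      (fun j => (integrable_proj ℱ j Y).aestronglyMeasurable)
      (by simpa only [eLpNorm_one_eq_lintegral_enorm] using hsum)
  filter_upwards [hs, hY.ae_tendsto_condExp_atBot hsum, hY.ae_tendsto_condExp_atTop]
    with ω hs h1 h2
  have hs' : Summable fun j : ℤ => proj ℱ μ j Y ω := hs.of_norm
  have hp : HasSum (fun n : ℕ => proj ℱ μ (n : ℤ) Y ω) (Y ω - (μ[Y | ℱ (-1)]) ω) := by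
    have h3 : Summable fun n : ℕ => proj ℱ μ (n : ℤ) Y ω :=
      hs'.comp_injective (i := fun n : ℕ => (n : ℤ)) Nat.cast_injective
    refine h3.hasSum_iff_tendsto_nat.2 ?_
    simp only [sum_range_proj]
    exact h2.sub tendsto_const_nhds
  have hn : HasSum (fun n : ℕ => proj ℱ μ (-((n : ℤ) + 1)) Y ω) ((μ[Y | ℱ (-1)]) ω - 0) := by
    have h3 : Summable fun n : ℕ => proj ℱ μ (-((n : ℤ) + 1)) Y ω :=
      hs'.comp_injective injective_neg_natCast_add_one
    refine h3.hasSum_iff_tendsto_nat.2 ?_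
    simp only [sum_range_proj_neg]
    exact tendsto_const_nhds.sub h1
  have := HasSum.of_nat_of_neg_add_one (f := fun j : ℤ => proj ℱ μ j Y ω) hp hn
  rwa [sub_zero, sub_add_cancel] at this

end Decomposition

/-! ### Orlicz norm and modular -/

section Modular

variable {Ω : Type*} {mΩ : MeasurableSpace Ω} {μ : Measure Ω} {α : ℝ} {Ψ : ℝ → ℝ}

lemma ClassA.lintegral_le_one_of_orliczNorm_lt (h : ClassA α Ψ) {X : Ω → ℝ} {q : ℝ}
    (hX : orliczNorm Ψ X μ < ENNReal.ofReal q) :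
    ∫⁻ ω, ENNReal.ofReal (Ψ |X ω / q|) ∂μ ≤ 1 := by
  simp only [orliczNorm, iInf_lt_iff] at hX
  obtain ⟨c, ⟨hc0, hc⟩, hcq⟩ := hX
  have hcq' : c < q := (ENNReal.ofReal_lt_ofReal_iff_of_nonneg hc0.le).1 hcq
  refine (lintegral_mono fun ω => ENNReal.ofReal_le_ofReal ?_).trans hc
  rw [abs_div, abs_of_pos (hc0.trans hcq')]
  have h1 : |X ω| / q ≤ |X ω| / c := by gcongr
  exact h.monotoneOn (Set.mem_Ici.2 (div_nonneg (abs_nonneg _) (hc0.trans hcq').le))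
    (Set.mem_Ici.2 (by positivity)) h1

/-- Fatou's lemma for the modular. -/
lemma ClassA.lintegral_le_one_of_tendsto (h : ClassA α Ψ) {ι : Type*} {u : Filter ι} [u.NeBot]
    [u.IsCountablyGenerated] {X : ι → Ω → ℝ} {Z : Ω → ℝ}
    (hX : ∀ i, AEStronglyMeasurable (X i) μ)
    (hlim : ∀ᵐ ω ∂μ, Tendsto (fun i => X i ω) u (𝓝 (Z ω)))
    (hle : ∀ i, ∫⁻ ω, ENNReal.ofReal (Ψ |X i ω|) ∂μ ≤ 1) :
    ∫⁻ ω, ENNReal.ofReal (Ψ |Z ω|) ∂μ ≤ 1 := by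
  calc ∫⁻ ω, ENNReal.ofReal (Ψ |Z ω|) ∂μ
      = ∫⁻ ω, liminf (fun i => ENNReal.ofReal (Ψ |X i ω|)) u ∂μ := by
        refine lintegral_congr_ae ?_
        filter_upwards [hlim] with ω hω
        exact ((ENNReal.continuous_ofReal.tendsto _).comp
          ((h.continuous_abs.tendsto _).comp hω)).liminf_eq.symm
    _ ≤ liminf (fun i => ∫⁻ ω, ENNReal.ofReal (Ψ |X i ω|) ∂μ) u :=
        lintegral_liminf_le' fun i =>
          (h.continuous_abs.comp_aestronglyMeasurable (hX i)).aemeasurable.ennreal_ofReal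
    _ ≤ 1 := liminf_le_of_frequently_le' (Frequently.of_forall hle)

/-- Convexity of the modular, for weights of total mass at most `1`. -/
lemma ClassA.lintegral_sum_le_one (h : ClassA α Ψ) (hconv : ConvexOn ℝ (Set.Ici 0) Ψ)
    {ι : Type*} (J : Finset ι) {w : ι → ℝ} (hw : ∀ i, 0 ≤ w i) (hw1 : ∑ i ∈ J, w i ≤ 1)
    {X : ι → Ω → ℝ} (hX : ∀ i, AEStronglyMeasurable (X i) μ)
    (hle : ∀ i, ∫⁻ ω, ENNReal.ofReal (Ψ |X i ω|) ∂μ ≤ 1) :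
    ∫⁻ ω, ENNReal.ofReal (Ψ |∑ i ∈ J, w i * X i ω|) ∂μ ≤ 1 := by
  have hpt : ∀ ω, Ψ |∑ i ∈ J, w i * X i ω| ≤ ∑ i ∈ J, w i * Ψ |X i ω| := by
    intro ω
    have hJ := hconv.map_add_sum_le (t := J) (w := w) (v := 1 - ∑ i ∈ J, w i) (q := 0)
      (p := fun i => |X i ω|) (fun i _ => hw i) (by ring) (fun i _ => Set.mem_Ici.2 (abs_nonneg _))
      (by linarith) (Set.mem_Ici.2 le_rfl)
    simp only [smul_eq_mul, mul_zero, zero_add, h.map_zero] at hJ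
    have habs : |∑ i ∈ J, w i * X i ω| ≤ ∑ i ∈ J, w i * |X i ω| := by
      refine (Finset.abs_sum_le_sum_abs _ _).trans_eq (Finset.sum_congr rfl fun i _ => ?_)
      rw [abs_mul, abs_of_nonneg (hw i)]
    exact (h.monotoneOn (Set.mem_Ici.2 (abs_nonneg _))
      (Set.mem_Ici.2 ((abs_nonneg _).trans habs)) habs).trans hJ
  have hm : ∀ i, AEMeasurable (fun ω => ENNReal.ofReal (Ψ |X i ω|)) μ := fun i =>
    (h.continuous_abs.comp_aestronglyMeasurable (hX i)).aemeasurable.ennreal_ofReal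
  calc ∫⁻ ω, ENNReal.ofReal (Ψ |∑ i ∈ J, w i * X i ω|) ∂μ
      ≤ ∫⁻ ω, ∑ i ∈ J, ENNReal.ofReal (w i) * ENNReal.ofReal (Ψ |X i ω|) ∂μ := by
        refine lintegral_mono fun ω => (ENNReal.ofReal_le_ofReal (hpt ω)).trans_eq ?_
        rw [ENNReal.ofReal_sum_of_nonneg fun i _ =>
          mul_nonneg (hw i) (h.nonneg _ (abs_nonneg _))]
        exact Finset.sum_congr rfl fun i _ => ENNReal.ofReal_mul (hw i)
    _ = ∑ i ∈ J, ENNReal.ofReal (w i) * ∫⁻ ω, ENNReal.ofReal (Ψ |X i ω|) ∂μ := by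
        rw [lintegral_finsetSum' _ fun i _ => (hm i).const_mul _]
        exact Finset.sum_congr rfl fun i _ => lintegral_const_mul'' _ (hm i)
    _ ≤ ∑ i ∈ J, ENNReal.ofReal (w i) :=
        Finset.sum_le_sum fun i _ => mul_le_of_le_one_right' (hle i)
    _ = ENNReal.ofReal (∑ i ∈ J, w i) := (ENNReal.ofReal_sum_of_nonneg fun i _ => hw i).symm
    _ ≤ 1 := ENNReal.ofReal_le_one.2 hw1

/-- `Ψ` dominates a multiple of `x ^ 2` for large `x`, so the unit ball of the modular is bounded
in `L²`. -/
lemma ClassA.exists_eLpNorm_two_le [IsProbabilityMeasure μ] (h : ClassA α Ψ)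
    (hsq : ConvexOn ℝ (Set.Ici 0) fun x : ℝ => Ψ (Real.sqrt x))
    (hne : ∃ x : ℝ, 0 ≤ x ∧ Ψ x ≠ 0) :
    ∃ B : ℝ, 0 < B ∧ ∀ (X : Ω → ℝ) (q : ℝ), 0 < q →
      ∫⁻ ω, ENNReal.ofReal (Ψ |X ω / q|) ∂μ ≤ 1 → eLpNorm X 2 μ ≤ ENNReal.ofReal (B * q) := by
  obtain ⟨x₀, hx₀, hΨ⟩ := hne
  have hx0 : 0 < x₀ := hx₀.lt_of_ne fun h0 => hΨ (h0 ▸ h.map_zero)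
  have hΨ0 : 0 < Ψ x₀ := (h.nonneg _ hx₀).lt_of_ne' hΨ
  have hpt : ∀ x : ℝ, x ^ 2 ≤ x₀ ^ 2 + x₀ ^ 2 / Ψ x₀ * Ψ |x| := by
    intro x
    have hΨx := h.nonneg _ (abs_nonneg x)
    rcases le_total |x| x₀ with hle | hle
    · have h1 : |x| ^ 2 ≤ x₀ ^ 2 := by gcongr
      have h2 : 0 ≤ x₀ ^ 2 / Ψ x₀ * Ψ |x| := by positivity
      rw [sq_abs] at h1
      linarith
    · have h1 := h.mul_sq_le hsq hx₀ hle
      have h2 : x ^ 2 ≤ x₀ ^ 2 / Ψ x₀ * Ψ |x| := by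
        rw [div_mul_eq_mul_div, le_div_iff₀ hΨ0]
        rw [sq_abs] at h1
        linarith
      linarith [sq_nonneg x₀]
  have hb : 0 < x₀ ^ 2 + x₀ ^ 2 / Ψ x₀ := by positivity
  refine ⟨√(x₀ ^ 2 + x₀ ^ 2 / Ψ x₀), Real.sqrt_pos.2 hb, fun X q hq hle => ?_⟩
  have hsc : X = q • fun ω => X ω / q := by
    ext ω
    simp only [Pi.smul_apply, smul_eq_mul]
    field_simp
  have h1 : ∫⁻ ω, ‖X ω / q‖ₑ ^ (2 : ℝ) ∂μ ≤ ENNReal.ofReal (x₀ ^ 2 + x₀ ^ 2 / Ψ x₀) := by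
    calc ∫⁻ ω, ‖X ω / q‖ₑ ^ (2 : ℝ) ∂μ
        ≤ ∫⁻ ω, (ENNReal.ofReal (x₀ ^ 2) +
            ENNReal.ofReal (x₀ ^ 2 / Ψ x₀) * ENNReal.ofReal (Ψ |X ω / q|)) ∂μ := by
          refine lintegral_mono fun ω => ?_
          rw [← ofReal_norm, Real.norm_eq_abs, ENNReal.ofReal_rpow_of_nonneg
            (abs_nonneg _) zero_le_two, Real.rpow_two, sq_abs, ← ENNReal.ofReal_mul (by positivity),
            ← ENNReal.ofReal_add (by positivity)
              (mul_nonneg (by positivity) (h.nonneg _ (abs_nonneg _)))]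
          exact ENNReal.ofReal_le_ofReal (hpt _)
      _ = ENNReal.ofReal (x₀ ^ 2) +
            ENNReal.ofReal (x₀ ^ 2 / Ψ x₀) * ∫⁻ ω, ENNReal.ofReal (Ψ |X ω / q|) ∂μ := by
          rw [lintegral_add_left measurable_const, lintegral_const_mul' _ _ ENNReal.ofReal_ne_top,
            lintegral_const, measure_univ, mul_one]
      _ ≤ ENNReal.ofReal (x₀ ^ 2) + ENNReal.ofReal (x₀ ^ 2 / Ψ x₀) := by
          gcongr
          exact mul_le_of_le_one_right' hle
      _ = _ := (ENNReal.ofReal_add (by positivity) (by positivity)).symm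
  have h2 : eLpNorm (fun ω => X ω / q) 2 μ ≤
      ENNReal.ofReal √(x₀ ^ 2 + x₀ ^ 2 / Ψ x₀) := by
    rw [eLpNorm_eq_lintegral_rpow_enorm_toReal two_ne_zero ENNReal.ofNat_ne_top,
      ENNReal.toReal_ofNat, Real.sqrt_eq_rpow, ← ENNReal.ofReal_rpow_of_nonneg hb.le (by norm_num)]
    gcongr
  rw [hsc, eLpNorm_const_smul, mul_comm, ENNReal.ofReal_mul (Real.sqrt_nonneg _),
    Real.enorm_of_nonneg hq.le]
  gcongr

end Modular

/-! ### Weighted sums of regular random variables -/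

section WeightedSums

variable {Ω : Type*} {mΩ : MeasurableSpace Ω} {μ : Measure Ω} {α : ℝ} {Ψ : ℝ → ℝ}

lemma exists_summable_gt {p : ℤ → ℝ≥0} (hp : Summable p) {Q : ℝ} (hQ : ∑' j, (p j : ℝ) < Q) :
    ∃ q : ℤ → ℝ, (∀ j, (p j : ℝ) < q j) ∧ Summable q ∧ ∑' j, q j ≤ Q := by
  obtain ⟨w, hw, c, hwc, hc⟩ := NNReal.exists_pos_sum_of_countable
    (ε := (Q - ∑' j, (p j : ℝ)).toNNReal) (by simpa using hQ) ℤ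
  have hw' : HasSum (fun j => (w j : ℝ)) c := NNReal.hasSum_coe.2 hwc
  have hs := (NNReal.summable_coe.2 hp).hasSum.add hw'
  refine ⟨fun j => p j + w j, fun j => by simpa using hw j, hs.summable, ?_⟩
  rw [hs.tsum_eq]
  have := NNReal.coe_lt_coe.2 hc
  rw [Real.coe_toNNReal _ (by linarith)] at this
  linarith

lemma condExp_proj_div [IsFiniteMeasure μ] (ℱ : Filtration ℤ mΩ) (j : ℤ) (Y : Ω → ℝ) (q : ℝ) :
    μ[fun ω => proj ℱ μ j Y ω / q | ℱ (j - 1)] =ᵐ[μ] 0 := by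
  have h1 := condExp_smul (μ := μ) q⁻¹ (proj ℱ μ j Y) (ℱ (j - 1))
  have heq : (fun ω => proj ℱ μ j Y ω / q) = q⁻¹ • proj ℱ μ j Y := by
    ext ω
    simp [div_eq_inv_mul]
  rw [heq]
  filter_upwards [h1, condExp_proj (μ := μ) ℱ j Y] with ω h1 h2
  rw [h1, Pi.smul_apply, h2, Pi.zero_apply, smul_zero]

/-- The moment inequality for finite sums, in terms of modulars. For each lag `j` the increments
`P_{k-j}(Y_k)` form a martingale difference sequence in `k`; the lags are then summed by
convexity. -/
lemma ClassA.lintegral_finset_sum_le_one [IsProbabilityMeasure μ] (h : ClassA α Ψ) (hα : 0 < α)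
    (hconv : ConvexOn ℝ (Set.Ici 0) Ψ)
    (hsq : ConvexOn ℝ (Set.Ici 0) fun x : ℝ => Ψ (Real.sqrt x))
    (hne : ∃ x : ℝ, 0 ≤ x ∧ Ψ x ≠ 0) {ℱ : Filtration ℤ mΩ} {Y : ℤ → Ω → ℝ}
    (hY : ∀ k, IsRegular ℱ μ (Y k)) {p : ℤ → ℝ≥0}
    (hp : ∀ k j : ℤ, orliczNorm Ψ (proj ℱ μ (k - j) (Y k)) μ ≤ (p j : ℝ≥0∞))
    (hsum : Summable p) (c : ℤ → ℝ) (G : Finset ℤ) {Q σ : ℝ} (hQ : ∑' j, (p j : ℝ) < Q)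
    (hσ : 0 < σ) (hcσ : ∑ k ∈ G, c k ^ 2 ≤ σ ^ 2) :
    ∫⁻ ω, ENNReal.ofReal (Ψ |(∑ k ∈ G, c k * Y k ω) / (momentConst α * Q * σ)|) ∂μ ≤ 1 := by
  have hC := momentConst_pos α
  have hQ0 : 0 < Q := (tsum_nonneg fun j => (p j).coe_nonneg).trans_lt hQ
  -- `q j > p j` is admissible in the infimum defining the norm, and `q j ≠ 0` even if `p j = 0`.
  obtain ⟨q, hpq, hqs, hqQ⟩ := exists_summable_gt hsum hQ
  have hq0 : ∀ j, 0 < q j := fun j => (p j).coe_nonneg.trans_lt (hpq j)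
  have hmod : ∀ k j, ∫⁻ ω, ENNReal.ofReal (Ψ |proj ℱ μ (k - j) (Y k) ω / q j|) ∂μ ≤ 1 :=
    fun k j => h.lintegral_le_one_of_orliczNorm_lt ((hp k j).trans_lt (by
      rw [← ENNReal.ofReal_coe_nnreal]
      exact (ENNReal.ofReal_lt_ofReal_iff (hq0 j)).2 (hpq j)))
  have hdec : ∀ᵐ ω ∂μ, ∀ k, HasSum (fun j => proj ℱ μ (k - j) (Y k) ω) (Y k ω) := by
    obtain ⟨B, hB, hBX⟩ := h.exists_eLpNorm_two_le (μ := μ) hsq hne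
    refine ae_all_iff.2 fun k => ?_
    have hfin : ∑' j : ℤ, ∫⁻ ω, ‖proj ℱ μ j (Y k) ω‖ₑ ∂μ ≠ ∞ := by
      rw [← (Equiv.subLeft k).tsum_eq]
      refine ne_top_of_le_ne_top (hqs.mul_left B).tsum_ofReal_ne_top
        (ENNReal.tsum_le_tsum fun j => ?_)
      rw [Equiv.subLeft_apply, ← eLpNorm_one_eq_lintegral_enorm]
      exact (eLpNorm_le_eLpNorm_of_exponent_le one_le_two
        (integrable_proj ℱ _ _).aestronglyMeasurable).trans (hBX _ _ (hq0 j) (hmod k j))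
    filter_upwards [(hY k).ae_hasSum_proj hfin] with ω hω
    exact (Equiv.subLeft k).hasSum_iff.2 hω
  have hUm : ∀ j : ℤ, AEStronglyMeasurable
      (fun ω => (∑ k ∈ G, c k / σ * (proj ℱ μ (k - j) (Y k) ω / q j)) / momentConst α) μ :=
    fun j => ((integrable_finsetSum G fun k _ =>
      ((integrable_proj ℱ (k - j) (Y k)).div_const (q j)).const_mul
        (c k / σ)).div_const _).aestronglyMeasurable
  have hU : ∀ j : ℤ, ∫⁻ ω, ENNReal.ofReal
      (Ψ |(∑ k ∈ G, c k / σ * (proj ℱ μ (k - j) (Y k) ω / q j)) / momentConst α|) ∂μ ≤ 1 := by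
    intro j
    have := h.lintegral_sum_martingaleDiff_le_one (μ := μ) hα hconv hsq (fun k => ℱ (k - j))
      (fun k l hkl => ℱ.mono (by omega)) (fun k => ℱ.le _)
      (z := fun k ω => proj ℱ μ (k - j) (Y k) ω / q j) (a := fun k => c k / σ)
      (fun k =>
        ((stronglyMeasurable_proj ℱ (k - j) (Y k)).measurable.div_const _).stronglyMeasurable)
      (fun k => (integrable_proj ℱ (k - j) (Y k)).div_const _)
      (fun k => by
        have := condExp_proj_div (μ := μ) ℱ (k - j) (Y k) (q j)
        rwa [show k - j - 1 = k - 1 - j by ring] at this)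
      (fun k => hmod k j) G
      (by
        simp only [div_pow]
        rw [← Finset.sum_div]
        exact (div_le_one (by positivity)).2 hcσ)
    simpa only [abs_div, abs_of_pos hC] using this
  refine h.lintegral_le_one_of_tendsto (u := (atTop : Filter (Finset ℤ)))
    (X := fun J ω => ∑ j ∈ J, q j / Q *
      ((∑ k ∈ G, c k / σ * (proj ℱ μ (k - j) (Y k) ω / q j)) / momentConst α))
    (fun J => Finset.aestronglyMeasurable_fun_sum J fun j _ => (hUm j).const_mul _) ?_
    fun J => h.lintegral_sum_le_one hconv J (fun j => (div_pos (hq0 j) hQ0).le) ?_ hUm hU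
  · filter_upwards [hdec] with ω hω
    have h1 : HasSum (fun j => ∑ k ∈ G, c k * proj ℱ μ (k - j) (Y k) ω)
        (∑ k ∈ G, c k * Y k ω) := hasSum_sum fun k _ => (hω k).mul_left (c k)
    have h2 := h1.div_const (momentConst α * Q * σ)
    refine h2.congr fun J => Finset.sum_congr rfl fun j _ => ?_
    have := hq0 j
    simp only
    rw [Finset.sum_div, Finset.sum_div, Finset.mul_sum]
    refine Finset.sum_congr rfl fun k _ => ?_
    field_simp
  · rw [← Finset.sum_div, div_le_one hQ0]
    exact (hqs.sum_le_tsum J fun j _ => (hq0 j).le).trans hqQ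

end WeightedSums

/-! ### Unconditional convergence in `L²` and the Orlicz bound for the sum -/

section Series

variable {Ω : Type*} {mΩ : MeasurableSpace Ω} {μ : Measure Ω} {α : ℝ} {Ψ : ℝ → ℝ}

/-- The Cauchy criterion for unconditional convergence in `L²`, in terms of functions. -/
lemma exists_hasL2Sum {Z : ℤ → Ω → ℝ} (hZ : ∀ k, MemLp (Z k) 2 μ)
    (hC : ∀ ε > 0, ∃ s : Finset ℤ, ∀ t : Finset ℤ, Disjoint t s →
      eLpNorm (fun ω => ∑ k ∈ t, Z k ω) 2 μ < ENNReal.ofReal ε) :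
    ∃ S : Ω → ℝ, HasL2Sum μ Z S := by
  have hsum : ∀ t : Finset ℤ, MemLp (fun ω => ∑ k ∈ t, Z k ω) 2 μ := fun t =>
    memLp_finsetSum t fun k _ => hZ k
  have htoLp : ∀ t : Finset ℤ, ∑ k ∈ t, (hZ k).toLp (Z k) = (hsum t).toLp _ := by
    intro t
    induction t using Finset.induction_on with
    | empty =>
      simp only [Finset.sum_empty]
      exact (MemLp.toLp_zero _).symm
    | insert a t ha ih =>
      rw [Finset.sum_insert ha, ih, ← MemLp.toLp_add]
      exact MemLp.toLp_congr _ _ (Eventually.of_forall fun ω => by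
        simp [Finset.sum_insert ha])
  have hs : Summable fun k => (hZ k).toLp (Z k) := by
    rw [summable_iff_vanishing_norm]
    intro ε hε
    obtain ⟨s, hs⟩ := hC ε hε
    refine ⟨s, fun t ht => ?_⟩
    rw [htoLp, Lp.norm_toLp]
    exact (ENNReal.toReal_lt_of_lt_ofReal (hs t ht))
  obtain ⟨S, hS⟩ := hs
  refine ⟨S, Lp.memLp S, ?_⟩
  have h1 : Tendsto (fun t : Finset ℤ => (hsum t).toLp _) atTop (𝓝 ((Lp.memLp S).toLp S)) := by
    rw [Lp.toLp_coeFn]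
    exact hS.congr htoLp
  exact (Lp.tendsto_Lp_iff_tendsto_eLpNorm'' _ hsum _ (Lp.memLp S)).1 h1

lemma orliczNorm_le_of_lintegral_le {X : Ω → ℝ} {q : ℝ} (hq : 0 < q)
    (hX : ∫⁻ ω, ENNReal.ofReal (Ψ |X ω / q|) ∂μ ≤ 1) :
    orliczNorm Ψ X μ ≤ ENNReal.ofReal q := by
  refine iInf₂_le q ⟨hq, ?_⟩
  simpa only [abs_div, abs_of_pos hq] using hX

lemma HasL2Sum.exists_seq_tendsto_ae {Z : ℤ → Ω → ℝ} {S : Ω → ℝ} (hS : HasL2Sum μ Z S)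
    (hZ : ∀ k, AEStronglyMeasurable (Z k) μ) :
    ∃ G : ℕ → Finset ℤ, ∀ᵐ ω ∂μ, Tendsto (fun n => ∑ k ∈ G n, Z k ω) atTop (𝓝 (S ω)) := by
  obtain ⟨G, -, hG⟩ := (tendstoInMeasure_of_tendsto_eLpNorm
    (f := fun (F : Finset ℤ) ω => ∑ j ∈ F, Z j ω) two_ne_zero
    (fun F => Finset.aestronglyMeasurable_fun_sum F fun k _ => hZ k)
    hS.1.aestronglyMeasurable hS.2).exists_seq_tendsto_ae'
  exact ⟨G, hG⟩

end Series

end OrliczMoment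

theorem mainTheorem7 (α : ℝ) (hα : 0 < α) :
    ∃ C : ℝ, 0 < C ∧
      ∀ (Ω : Type*) (mΩ : MeasurableSpace Ω) (μ : Measure Ω) (_ : IsProbabilityMeasure μ)
        (ℱ : Filtration ℤ mΩ) (Ψ : ℝ → ℝ) (Y : ℤ → Ω → ℝ) (p : ℤ → ℝ≥0) (c : ℤ → ℝ),
        OrliczMoment.ClassA α Ψ →
        (∃ x : ℝ, 0 ≤ x ∧ Ψ x ≠ 0) →
        ConvexOn ℝ (Set.Ici 0) Ψ →
        ConvexOn ℝ (Set.Ici 0) (fun x : ℝ => Ψ (Real.sqrt x)) →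
        (∀ k : ℤ, OrliczMoment.IsRegular ℱ μ (Y k)) →
        (∀ k j : ℤ,
          OrliczMoment.orliczNorm Ψ (OrliczMoment.proj ℱ μ (k - j) (Y k)) μ ≤ (p j : ℝ≥0∞)) →
        Summable p →
        Summable (fun j : ℤ => c j ^ 2) →
        (∃ S : Ω → ℝ, OrliczMoment.HasL2Sum μ (fun j ω => c j * Y j ω) S) ∧
        ∀ S : Ω → ℝ, OrliczMoment.HasL2Sum μ (fun j ω => c j * Y j ω) S →
          OrliczMoment.orliczNorm Ψ S μ ≤
            ENNReal.ofReal (C * (∑' j : ℤ, (p j : ℝ)) * Real.sqrt (∑' j : ℤ, c j ^ 2)) := by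
  have hC := OrliczMoment.momentConst_pos α
  refine ⟨OrliczMoment.momentConst α, hC, ?_⟩
  intro Ω mΩ μ _ ℱ Ψ Y p c h hne hconv hsq hY hp hsum hc
  have hD : 0 ≤ ∑' j, (p j : ℝ) := tsum_nonneg fun j => (p j).coe_nonneg
  have key := fun (c : ℤ → ℝ) (G : Finset ℤ) (Q σ : ℝ) =>
    h.lintegral_finset_sum_le_one hα hconv hsq hne hY hp hsum c G (Q := Q) (σ := σ)
  have hZm : ∀ k, AEStronglyMeasurable (fun ω => c k * Y k ω) μ := fun k =>
    ((hY k).integrable.const_mul (c k)).aestronglyMeasurable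
  constructor
  · obtain ⟨B, hB, hBX⟩ := h.exists_eLpNorm_two_le (μ := μ) hsq hne
    set Q := ∑' j, (p j : ℝ) + 1 with hQdef
    have hQ : ∑' j, (p j : ℝ) < Q := lt_add_one _
    have hQ0 : 0 < Q := hD.trans_lt hQ
    have hL2 : ∀ (G : Finset ℤ) (σ : ℝ), 0 < σ → ∑ k ∈ G, c k ^ 2 ≤ σ ^ 2 →
        eLpNorm (fun ω => ∑ k ∈ G, c k * Y k ω) 2 μ ≤
          ENNReal.ofReal (B * (OrliczMoment.momentConst α * Q * σ)) := fun G σ hσ hG =>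
      hBX _ _ (by positivity) (key c G Q σ hQ hσ hG)
    refine OrliczMoment.exists_hasL2Sum (fun k => ⟨hZm k, ?_⟩) fun ε hε => ?_
    · have := hL2 {k} (|c k| + 1) (by positivity) (by
        rw [Finset.sum_singleton, ← sq_abs]
        gcongr
        linarith)
      simp only [Finset.sum_singleton] at this
      exact this.trans_lt ENNReal.ofReal_lt_top
    · set σ := ε / (2 * (B * (OrliczMoment.momentConst α * Q))) with hσdef
      have hσ : 0 < σ := by positivity
      obtain ⟨s, hs⟩ := summable_iff_vanishing_norm.1 hc (σ ^ 2) (by positivity)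
      refine ⟨s, fun t ht => ?_⟩
      have h1 := (le_abs_self _).trans (hs t ht).le
      refine (hL2 t σ hσ h1).trans_lt ((ENNReal.ofReal_lt_ofReal_iff hε).2 ?_)
      have h2 : B * (OrliczMoment.momentConst α * Q * σ) = ε / 2 := by
        rw [hσdef]
        field_simp
      linarith
  · intro S hS
    obtain ⟨G, hG⟩ := hS.exists_seq_tendsto_ae hZm
    have hT : 0 ≤ ∑' j, c j ^ 2 := tsum_nonneg fun j => sq_nonneg _
    have hle : ∀ ε : ℝ, 0 < ε → OrliczMoment.orliczNorm Ψ S μ ≤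
        ENNReal.ofReal (OrliczMoment.momentConst α * (∑' j, (p j : ℝ) + ε) *
          (√(∑' j, c j ^ 2) + ε)) := by
      intro ε hε
      have hσ : 0 < √(∑' j, c j ^ 2) + ε := by positivity
      have hQ : 0 < ∑' j, (p j : ℝ) + ε := by positivity
      refine OrliczMoment.orliczNorm_le_of_lintegral_le (by positivity) ?_
      refine h.lintegral_le_one_of_tendsto (u := atTop)
        (fun n => (Finset.aestronglyMeasurable_fun_sum (G n) fun k _ => hZm k).mul_const _)
        (hG.mono fun ω hω => hω.mul_const _)
        fun n => key c (G n) _ _ (lt_add_of_pos_right _ hε) hσ ?_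
      calc ∑ k ∈ G n, c k ^ 2 ≤ ∑' j, c j ^ 2 := hc.sum_le_tsum _ fun j _ => sq_nonneg _
        _ = √(∑' j, c j ^ 2) ^ 2 := (Real.sq_sqrt hT).symm
        _ ≤ _ := by
          gcongr
          linarith
    have hlim : Tendsto (fun ε : ℝ => ENNReal.ofReal (OrliczMoment.momentConst α *
        (∑' j, (p j : ℝ) + ε) * (√(∑' j, c j ^ 2) + ε))) (𝓝[>] 0)
        (𝓝 (ENNReal.ofReal (OrliczMoment.momentConst α * (∑' j, (p j : ℝ)) *
          √(∑' j, c j ^ 2)))) := by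
      have hcont : Continuous fun ε : ℝ => ENNReal.ofReal (OrliczMoment.momentConst α *
          (∑' j, (p j : ℝ) + ε) * (√(∑' j, c j ^ 2) + ε)) :=
        ENNReal.continuous_ofReal.comp (by fun_prop)
      simpa using (hcont.tendsto 0).mono_left nhdsWithin_le_nhds
    exact ge_of_tendsto hlim (eventually_mem_nhdsWithin.mono fun ε hε => hle ε hε)
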